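/- Throughout, rings are associative and unital, not necessarily commutative. Elements $x,y$ of a ring $R$ are called orthogonal, $x\perp y$, if $xRy=0=yRx$. An element $u\in R$ is called quasi-invertible if there are $v,w\in R$ such that $(1-vu)\perp(1-uw)$, and $R^{-1}_q$ denotes the set of quasi-invertible elements of $R$. The ring $R$ is called a $QB$-ring (quasi-Bass ring) if whenever $ax+b=1$ with $a,x,b\in R$, there is a $y\in R$ such that $a+by\in R^{-1}_q$. Theorem. Let $(R_n)_{n\ge 0}$ be a sequence of $QB$-rings with surjective ring homomorphisms $\pi_n\colon R_{n+1}\to R_n$ for all $n\ge 0$. Then the inverse limit $$\varprojlim R_n=\Big\{(x_n)\in\prod_{n\ge 0} R_n : \pi_n(x_{n+1})=x_n \text{ for all } n\ge 0\Big\}$$ is also a $QB$-ring. -/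

import Mathlib

/-- Two elements `x`, `y` of a ring `R` are orthogonal, `x ⊥ y`, if `xRy = 0 = yRx`. -/
def RingPerp {R : Type*} [Ring R] (x y : R) : Prop :=
  (∀ r : R, x * r * y = 0) ∧ (∀ r : R, y * r * x = 0)

/-- `u` is quasi-invertible if `(1 - vu) ⊥ (1 - uw)` for some `v`, `w`. -/
def IsQuasiInvertible {R : Type*} [Ring R] (u : R) : Prop :=
  ∃ v w : R, RingPerp (1 - v * u) (1 - u * w)

/-- A unital ring `R` is a `QB`-ring (quasi-Bass ring) if whenever `ax + b = 1` in `R`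
there is a `y` in `R` such that `a + by` is quasi-invertible. -/
def IsQBRing (R : Type*) [Ring R] : Prop :=
  ∀ a x b : R, a * x + b = 1 → ∃ y : R, IsQuasiInvertible (a + b * y)

/-- The inverse limit of a sequence of rings with connecting morphisms
`π n : R (n + 1) → R n`: the ring of strings, as a subring of the product. -/
def ringInverseLimit {R : ℕ → Type*} [∀ n, Ring (R n)]
    (π : ∀ n, R (n + 1) →+* R n) : Subring (∀ n, R n) where
  carrier := {x | ∀ n, π n (x (n + 1)) = x n}
  mul_mem' := fun {x y} hx hy n => by
    change π n (x (n + 1) * y (n + 1)) = x n * y n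
    rw [map_mul, hx n, hy n]
  one_mem' := fun n => map_one (π n)
  add_mem' := fun {x y} hx hy n => by
    change π n (x (n + 1) + y (n + 1)) = x n + y n
    rw [map_add, hx n, hy n]
  zero_mem' := fun n => map_zero (π n)
  neg_mem' := fun {x} hx n => by
    change π n (- x (n + 1)) = - x n
    rw [map_neg, hx n]

/-!
A quasi-invertible element `u` has a quasi-inverse `v`, satisfying `uvu = u`, `vuv = v` and
`(1 - vu) ⊥ (1 - uv)`. The theorem follows from a lifting property of a surjection `f : A → B` with
`A` a `QB`-ring: if `ax + b = 1` in `A`, and `f a + f b * y₀` has quasi-inverse `v₀` in `B`, then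
`y₀` and `v₀` lift to `y` and `v` in `A` such that `v` is a quasi-inverse of `a + by`
(`IsQBRing.exists_lift`). Iterating along the tower produces coherent strings `y` and `v`, and the
orthogonality relation in the inverse limit is checked in each coordinate.

For the lifting property, an arbitrary lift of `y₀` may be absorbed into `a`, so that `f a` is itself
quasi-invertible, and `x`, `b` may then be changed so that `f x` is a quasi-inverse of `f a` and
`f b = 1 - f a * f x` is an idempotent `p₀`. Since `A` is a `QB`-ring, some `u = a + by` is
quasi-invertible, but `f u = f a + p₀ * f y` need not be `f a`. It is `(1 + p₀ * f y * f x) * f a`,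
where the first factor is unipotent. To undo this factor inside `a + bA`, choose a
quasi-inverse `v` of `u` over `f x`; then `p = 1 - uv` annihilates `u = a + by` from the left, so
`p = p b (1 - yx)`, and `g = b (1 - yx) p` is an idempotent in `bA`. It yields a square-zero element
`n = g * byx * (1 - g)` of `bA` lifting `p₀ * f y * f x`, and `(1 - n) u` is a quasi-invertible
element of `a + bA` lifting `f a` (`IsQBRing.exists_correction`). Finally, once an element over
`f a` is quasi-invertible, all quasi-inverses of `f a` lift to quasi-inverses of it
(`IsQuasiInverse.exists_lift`).
-/

/-- `v` is a quasi-inverse of `u`: the elements `u` and `v` are von Neumann inverses of each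
other, and the idempotents `1 - vu` and `1 - uv` are orthogonal. -/
structure IsQuasiInverse {A : Type*} [Ring A] (u v : A) : Prop where
  left_eq : u * v * u = u
  right_eq : v * u * v = v
  perp : RingPerp (1 - v * u) (1 - u * v)

section Ring

variable {A : Type*} [Ring A]

lemma RingPerp.mul {x y : A} (h : RingPerp x y) (r s t q : A) :
    RingPerp (r * x * s) (t * y * q) := by
  refine ⟨fun z => ?_, fun z => ?_⟩
  · have e : r * x * s * z * (t * y * q) = r * (x * (s * z * t) * y) * q := by
      simp only [mul_assoc]
    rw [e, h.1]; simp
  · have e : t * y * q * z * (r * x * s) = t * (y * (q * z * r) * x) * s := by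
      simp only [mul_assoc]
    rw [e, h.2]; simp

/-- If `uvu = u` but `v` is not known to satisfy `vuv = v`, then `vuv` satisfies both, without
changing the idempotents `uv` and `vu`. -/
lemma IsQuasiInverse.of_left_eq {u v : A} (h : u * v * u = u)
    (hp : RingPerp (1 - v * u) (1 - u * v)) : IsQuasiInverse u (v * u * v) := by
  have h1 : v * u * v * u = v * u := by
    rw [mul_assoc (v * u), mul_assoc v, ← mul_assoc u, h]
  have h2 : u * (v * u * v) = u * v := by
    rw [← mul_assoc, ← mul_assoc, h]
  refine ⟨by rw [h2, h], ?_, by rwa [h1, h2]⟩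
  rw [h1, mul_assoc v u, h2, ← mul_assoc]

lemma IsQuasiInverse.isQuasiInvertible {u v : A} (h : IsQuasiInverse u v) :
    IsQuasiInvertible u :=
  ⟨v, v, h.perp⟩

lemma IsQuasiInvertible.exists_isQuasiInverse {u : A} (h : IsQuasiInvertible u) :
    ∃ v, IsQuasiInverse u v := by
  obtain ⟨v, w, h⟩ := h
  have e1 : 1 - (v + w - w * u * v) * u = (1 - w * u) * (1 - v * u) := by noncomm_ring
  have e2 : 1 - u * (v + w - w * u * v) = (1 - u * w) * (1 - u * v) := by noncomm_ring
  refine ⟨_, IsQuasiInverse.of_left_eq (v := v + w - w * u * v) ?_ ?_⟩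
  · have h0 : u - u * (v + w - w * u * v) * u = (1 - u * w) * u * (1 - v * u) := by noncomm_ring
    rw [h.2 u, sub_eq_zero] at h0
    exact h0.symm
  · rw [e1, e2]
    refine ⟨fun r => ?_, fun r => ?_⟩
    · have e : (1 - w * u) * (1 - v * u) * r * ((1 - u * w) * (1 - u * v)) =
          (1 - w * u) * ((1 - v * u) * r * (1 - u * w)) * (1 - u * v) := by
        simp only [mul_assoc]
      rw [e, h.1]; simp
    · have e : (1 - u * w) * (1 - u * v) * r * ((1 - w * u) * (1 - v * u)) =
          (1 - u * w) * ((1 - u * v) * r * (1 - w * u)) * (1 - v * u) := by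
        simp only [mul_assoc]
      rw [e, h.2]

lemma IsQuasiInverse.mul_unit {u v : A} (h : IsQuasiInverse u v) (g : Aˣ) :
    IsQuasiInverse (g * u) (v * ↑g⁻¹) := by
  have e1 : v * ↑g⁻¹ * (g * u) = v * u := by
    rw [mul_assoc, Units.inv_mul_cancel_left]
  refine ⟨?_, ?_, ?_⟩
  · rw [mul_assoc, e1, mul_assoc, ← mul_assoc u, h.left_eq]
  · rw [e1, ← mul_assoc, h.right_eq]
  · have e2 : 1 - g * u * (v * ↑g⁻¹) = g * (1 - u * v) * ↑g⁻¹ := by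
      rw [mul_sub, sub_mul, mul_one, Units.mul_inv]
      simp only [mul_assoc]
    rw [e1, e2]
    simpa using h.perp.mul 1 1 g ↑g⁻¹

/-- The unit `1 - n` attached to an element `n` of square zero. -/
def unitOneSub (n : A) (hn : n * n = 0) : Aˣ where
  val := 1 - n
  inv := 1 + n
  val_inv := by rw [mul_add, sub_mul, sub_mul, hn]; simp
  inv_val := by rw [mul_sub, add_mul, add_mul, hn]; simp

end Ring

section Lift

variable {A B : Type*} [Ring A] [Ring B] {f : A →+* B}

/-- Any two quasi-inverses of `u` differ by an element of the form `(1 - vu)s + t(1 - uv)`. -/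
lemma IsQuasiInverse.eq_add {u v w : A} (hv : IsQuasiInverse u v) (hw : IsQuasiInverse u w) :
    w = v + (1 - v * u) * w + v * u * w * (1 - u * v) := by
  have h : v * u * w * (1 - u * v) = v * u * w - v := by
    have : v * u * w * (u * v) = v * (u * w * u) * v := by simp only [mul_assoc]
    rw [mul_sub, mul_one, this, hw.left_eq, hv.right_eq]
  rw [h, sub_mul, one_mul]
  abel

/-- Quasi-inverses lift along a surjection, over any fixed quasi-invertible element. -/
lemma IsQuasiInverse.exists_lift (hf : Function.Surjective f) {u : A} {v₀ : B}
    (hu : IsQuasiInvertible u) (h : IsQuasiInverse (f u) v₀) :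
    ∃ v, f v = v₀ ∧ IsQuasiInverse u v := by
  obtain ⟨v, hv⟩ := hu.exists_isQuasiInverse
  obtain ⟨s, rfl⟩ := hf v₀
  have hfv : IsQuasiInverse (f u) (f v) := by
    refine ⟨by rw [← map_mul, ← map_mul, hv.left_eq], by rw [← map_mul, ← map_mul, hv.right_eq],
      fun r => ?_, fun r => ?_⟩ <;> obtain ⟨r, rfl⟩ := hf r
    · simpa using congrArg f (hv.perp.1 r)
    · simpa using congrArg f (hv.perp.2 r)
  set w := v + (1 - v * u) * s + v * u * s * (1 - u * v) with hw
  have hfw : f w = f s := by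
    rw [hfv.eq_add h]; simp [hw]
  have h1 : (1 - u * v) * u = 0 := by rw [sub_mul, one_mul, hv.left_eq, sub_self]
  have h2 : u * (1 - v * u) = 0 := by
    rw [mul_sub, mul_one, ← mul_assoc, hv.left_eq, sub_self]
  have e1 : 1 - w * u = (1 - v * u) * (1 - s * u) := by
    rw [hw, add_mul, mul_assoc _ _ u, h1]; noncomm_ring
  have e2 : 1 - u * w = (1 - u * (v * u * s)) * (1 - u * v) := by
    rw [hw, mul_add, mul_add, ← mul_assoc u (1 - v * u), h2]; noncomm_ring
  refine ⟨w * u * w, ?_, IsQuasiInverse.of_left_eq ?_ ?_⟩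
  · rw [map_mul, map_mul, hfw, h.right_eq]
  · have : u - u * w * u = u * (1 - w * u) := by noncomm_ring
    rw [e1, ← mul_assoc, h2, zero_mul, sub_eq_zero] at this
    exact this.symm
  · rw [e1, e2]
    simpa using hv.perp.mul 1 (1 - s * u) (1 - u * (v * u * s)) 1

/-- The case of the lifting property in which `f x` is a quasi-inverse of `f a`. The condition
`f b * f y = 0` says that the correction `b * y` of `a` lies in the kernel of `f`. -/
lemma IsQBRing.exists_correction (hA : IsQBRing A) (hf : Function.Surjective f) {a x b : A}
    (hab : a * x + b = 1) (h : IsQuasiInverse (f a) (f x)) :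
    ∃ y, f b * f y = 0 ∧ IsQuasiInvertible (a + b * y) := by
  obtain ⟨y, hu⟩ := hA a x b hab
  have hb : f b = 1 - f a * f x := by
    rw [← map_mul, ← map_one f, ← map_sub, ← hab]; simp
  have hxb : f x * f b = 0 := by
    rw [hb, mul_sub, mul_one, ← mul_assoc, h.right_eq, sub_self]
  have hbb : f b * f b = f b := by
    nth_rw 1 [hb]
    rw [sub_mul, one_mul, mul_assoc, hxb, mul_zero, sub_zero]
  -- orthogonality of `1 - f a * f x` and `1 - f x * f a`
  have hbya : f b * f y * f x * f a = f b * f y := by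
    have := h.perp.2 (f y)
    rw [← hb, mul_sub, mul_one, sub_eq_zero] at this
    rw [mul_assoc, ← this]
  have hU : IsQuasiInverse (f (a + b * y)) (f x) := by
    have e1 : f x * f (a + b * y) = f x * f a := by
      rw [map_add, map_mul, mul_add, ← mul_assoc, hxb, zero_mul, add_zero]
    refine ⟨?_, by rw [e1, h.right_eq], ?_⟩
    · rw [mul_assoc, e1, map_add, map_mul, add_mul, ← mul_assoc, ← mul_assoc, h.left_eq, hbya]
    · have e2 : 1 - f (a + b * y) * f x = f b * (1 - f y * f x) := by
        rw [map_add, map_mul, add_mul, ← sub_sub, ← hb]; noncomm_ring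
      rw [e1, e2]
      have := h.perp.mul 1 1 1 (1 - f y * f x)
      rwa [← hb, one_mul, one_mul, mul_one] at this
  obtain ⟨v, hvx, hv⟩ := IsQuasiInverse.exists_lift hf hu hU
  set u := a + b * y with hu_def
  set p := 1 - u * v with hp
  have hpu : p * u = 0 := by rw [hp, sub_mul, one_mul, hv.left_eq, sub_self]
  have hpp : p * p = p := by
    nth_rw 2 [hp]
    rw [mul_sub, mul_one, ← mul_assoc, hpu, zero_mul, sub_zero]
  have hpb : p * (b * (1 - y * x)) = p := by
    have e : b * (1 - y * x) = a * x + b - u * x := by rw [hu_def]; noncomm_ring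
    rw [e, hab, mul_sub, mul_one, ← mul_assoc, hpu, zero_mul, sub_zero]
  set g := b * (1 - y * x) * p with hg
  have hgg : g * g = g := by
    have e : g * g = b * (1 - y * x) * (p * (b * (1 - y * x)) * p) := by
      simp only [hg, mul_assoc]
    rw [e, hpb, hpp]
  set d := f b * f y * f x with hd
  have hdb : d * f b = 0 := by rw [hd, mul_assoc, hxb, mul_zero]
  have hbd : f b * d = d := by rw [hd, ← mul_assoc, ← mul_assoc, hbb]
  have hdd : d * d = 0 := by rw [← hbd, ← mul_assoc, mul_assoc _ d, hdb]; simp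
  have hfp : f p = f b - d := by
    rw [hp, map_sub, map_one, map_mul, hvx, hu_def, map_add, map_mul, add_mul, ← sub_sub, ← hb]
  have hfg : f g = f b - d := by
    have e : f (b * (1 - y * x)) = f b - d := by
      rw [hd]; simp only [map_mul, map_sub, map_one]; noncomm_ring
    rw [hg, map_mul, e, hfp, sub_mul, mul_sub, mul_sub, hbb, hbd, hdb, hdd]
    simp
  -- `n` is the off-diagonal part, relative to the idempotent `g`, of a lift of `d`
  set n := g * (b * y * x) * (1 - g) with hn
  have hnn : n * n = 0 := by
    have e : n * n = g * (b * y * x) * ((1 - g) * g) * ((b * y * x) * (1 - g)) := by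
      simp only [hn, mul_assoc]
    rw [e, sub_mul, one_mul, hgg, sub_self]; simp
  have hfn : f n = d := by
    have e : f (b * y * x) = d := by simp only [map_mul, hd]
    rw [hn, map_mul, map_mul, e, map_sub, map_one, hfg, sub_mul, hbd, hdd, sub_zero, mul_sub,
      mul_one, mul_sub, hdb, hdd]
    simp
  have hy : b * (y - (1 - y * x) * p * (b * y * x) * (1 - g) * u) = b * y - n * u := by
    rw [mul_sub, hn, hg]; simp only [mul_assoc]
  refine ⟨y - (1 - y * x) * p * (b * y * x) * (1 - g) * u, ?_, ?_⟩
  · rw [← map_mul, hy, map_sub, map_mul, map_mul, hfn, hu_def, map_add, map_mul, mul_add,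
      ← mul_assoc d, hdb, hbya]
    simp
  · have e : a + (b * y - n * u) = (unitOneSub n hnn : Aˣ) * u := by
      change _ = (1 - n) * u
      rw [sub_mul, one_mul, ← add_sub_assoc]
    rw [hy, e]
    exact (hv.mul_unit _).isQuasiInvertible

/-- The lifting property when `f a` itself is quasi-invertible. -/
lemma IsQBRing.exists_lift_of_isQuasiInverse (hA : IsQBRing A) (hf : Function.Surjective f)
    {a x b : A} {v₀ : B} (hab : a * x + b = 1) (h : IsQuasiInverse (f a) v₀) :
    ∃ z, f z = 0 ∧ ∃ v, f v = v₀ ∧ IsQuasiInverse (a + b * z) v := by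
  obtain ⟨v, rfl⟩ := hf v₀
  have hb : f b = 1 - f a * f x := by
    rw [← map_mul, ← map_one f, ← map_sub, ← hab]; simp
  have hpa : (1 - f a * f v) * f a = 0 := by
    rw [sub_mul, one_mul, h.left_eq, sub_self]
  have hvp : f v * (1 - f a * f v) = 0 := by
    rw [mul_sub, mul_one, ← mul_assoc, h.right_eq, sub_self]
  have hpp : (1 - f a * f v) * (1 - f a * f v) = 1 - f a * f v := by
    rw [mul_sub, mul_one, ← mul_assoc, hpa, zero_mul, sub_zero]
  have hpb : (1 - f a * f v) * f b = 1 - f a * f v := by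
    rw [hb, mul_sub, mul_one, ← mul_assoc, hpa, zero_mul, sub_zero]
  -- `x' = v + x(1 - av)` maps to a quasi-inverse of `f a`, and `1 - ax' = b(1 - av)` is in `bA`
  have hab' : a * (v + x * (1 - a * v)) + b * (1 - a * v) = 1 := by
    have e : a * (v + x * (1 - a * v)) + b * (1 - a * v) =
        a * v + (a * x + b) * (1 - a * v) := by noncomm_ring
    rw [e, hab]; simp
  have hfx : f (v + x * (1 - a * v)) = f v + f x * (1 - f a * f v) := by simp
  have hx'a : f (v + x * (1 - a * v)) * f a = f v * f a := by
    rw [hfx, add_mul, mul_assoc _ _ (f a), hpa, mul_zero, add_zero]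
  have hq : IsQuasiInverse (f a) (f (v + x * (1 - a * v))) := by
    refine ⟨by rw [mul_assoc, hx'a, ← mul_assoc, h.left_eq], ?_, ?_⟩
    · have := h.perp.1 (f x)
      rw [sub_mul, sub_mul, one_mul, sub_eq_zero] at this
      rw [hx'a, hfx, mul_add, h.right_eq, ← mul_assoc, ← this]
    · have e : 1 - f a * f (v + x * (1 - a * v)) = f b * (1 - f a * f v) := by
        rw [hfx, hb]; noncomm_ring
      rw [hx'a, e]
      simpa using h.perp.mul 1 1 (f b) 1
  obtain ⟨y, hy, hu⟩ := hA.exists_correction hf hab' hq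
  have hz : f ((1 - a * v) * y) = 0 := by
    have e : f ((1 - a * v) * y) = (1 - f a * f v) * f y := by simp
    have e' : f (b * (1 - a * v)) = f b * (1 - f a * f v) := by simp
    rw [e]
    rw [e'] at hy
    calc (1 - f a * f v) * f y = (1 - f a * f v) * (f b * (1 - f a * f v) * f y) := by
          rw [← mul_assoc, ← mul_assoc, hpb, hpp]
      _ = 0 := by rw [hy, mul_zero]
  rw [mul_assoc] at hu
  refine ⟨_, hz, IsQuasiInverse.exists_lift hf hu ?_⟩
  rwa [map_add, map_mul f b, hz, mul_zero, add_zero]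

/-- The lifting property: along a surjection from a `QB`-ring, a solution `y₀` of the `QB`-condition
lifts to a solution, together with a given quasi-inverse `v₀`. -/
lemma IsQBRing.exists_lift (hA : IsQBRing A) (hf : Function.Surjective f) {a x b : A} {y₀ v₀ : B}
    (hab : a * x + b = 1) (h : IsQuasiInverse (f a + f b * y₀) v₀) :
    ∃ y v, f y = y₀ ∧ f v = v₀ ∧ IsQuasiInverse (a + b * y) v := by
  obtain ⟨y, rfl⟩ := hf y₀
  have hab' : (a + b * y) * x + b * (1 - y * x) = 1 := by
    have e : (a + b * y) * x + b * (1 - y * x) = a * x + b := by noncomm_ring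
    rw [e, hab]
  rw [← map_mul, ← map_add] at h
  obtain ⟨z, hz, v, hv, hq⟩ := hA.exists_lift_of_isQuasiInverse hf hab' h
  refine ⟨y + (1 - y * x) * z, v, by rw [map_add, map_mul, hz, mul_zero, add_zero], hv, ?_⟩
  rwa [mul_add, ← mul_assoc, ← add_assoc]

end Lift

theorem mainTheorem3 {R : ℕ → Type*} [∀ n, Ring (R n)]
    (π : ∀ n, R (n + 1) →+* R n) (hπ : ∀ n, Function.Surjective (π n))
    (hR : ∀ n, IsQBRing (R n)) :
    IsQBRing (ringInverseLimit π) := by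
  intro a x b hab
  have hab' (n : ℕ) : a.1 n * x.1 n + b.1 n = 1 := congrFun (congrArg Subtype.val hab) n
  let T (n : ℕ) := {q : R n × R n // IsQuasiInverse (a.1 n + b.1 n * q.1) q.2}
  have hstep (n : ℕ) (q : T n) : ∃ r : T (n + 1), π n r.1.1 = q.1.1 ∧ π n r.1.2 = q.1.2 := by
    have hq : IsQuasiInverse (π n (a.1 (n + 1)) + π n (b.1 (n + 1)) * q.1.1) q.1.2 := by
      rw [a.2 n, b.2 n]
      exact q.2
    obtain ⟨y, v, hy, hv, h⟩ := (hR (n + 1)).exists_lift (hπ n) (hab' (n + 1)) hq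
    exact ⟨⟨(y, v), h⟩, hy, hv⟩
  choose next hnext using hstep
  obtain ⟨y₀, hy₀⟩ := hR 0 _ _ _ (hab' 0)
  obtain ⟨v₀, hv₀⟩ := hy₀.exists_isQuasiInverse
  let s : ∀ n, T n := fun n => Nat.rec ⟨(y₀, v₀), hv₀⟩ next n
  let y : ringInverseLimit π := ⟨fun n => (s n).1.1, fun n => (hnext n (s n)).1⟩
  let v : ringInverseLimit π := ⟨fun n => (s n).1.2, fun n => (hnext n (s n)).2⟩
  refine ⟨y, v, v, fun r => ?_, fun r => ?_⟩
  · exact Subtype.ext (funext fun n => (s n).2.perp.1 (r.1 n))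
  · exact Subtype.ext (funext fun n => (s n).2.perp.2 (r.1 n))
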